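/- All monoidal categories are strict, and composition is written $gf$ or $g\circ f$ ("first $f$, then $g$"). **Convolution categories.** Let $\mathcal{C}$ be a braided category with braiding $\tau$, $(A,\mu,\eta)$ an algebra and $(C,\Delta,\varepsilon)$ a coalgebra in $\mathcal{C}$. For $n\in\mathbb{N}$ the object $C^{\otimes n}$ is a coalgebra, where the tensor product of coalgebras $C,C'$ has counit $\varepsilon\otimes\varepsilon'$ and coproduct $(\mathrm{id}_C\otimes\tau_{C,C'}\otimes\mathrm{id}_{C'})(\Delta\otimes\Delta')$. The category $\mathrm{Conv}_{\mathcal{C}}(C,A)$ has the non-negative integers as objects; there is no morphism $m\to n$ if $m\ne n$; the endomorphisms of $n$ are the morphisms $C^{\otimes n}\to A$ of $\mathcal{C}$, with composition $f\circ g=\mu(f\otimes g)\Delta_{C^{\otimes n}}$ and identity $\eta\,\varepsilon^{\otimes n}$. **Hopf diagrams without antipode.** Let $\mathcal{D}$ be the braided category generated by one object $*$ and the morphisms $$\Delta: *\to *\otimes *,\quad \varepsilon: *\to\mathbf{1},\quad \omega_+,\omega_-: *\otimes *\to\mathbf{1},\quad \theta_+,\theta_-: *\to\mathbf{1},$$ subject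 to the relations $$(\mathrm{id}_*\otimes\Delta)\Delta=(\Delta\otimes\mathrm{id}_*)\Delta,\qquad (\mathrm{id}_*\otimes\varepsilon)\Delta=\mathrm{id}_*=(\varepsilon\otimes\mathrm{id}_*)\Delta,$$ that is, the quotient of the free braided category on these data by the congruence (compatible with composition and $\otimes$) generated by the relations. Put $\mathcal{D}iag=\mathrm{Conv}_{\mathcal{D}}(*,\mathbf{1})$, where $*$ is a coalgebra by $\Delta,\varepsilon$ and $\mathbf{1}$ is the trivial algebra. **Hopf diagrams with antipode.** Let $\mathcal{D}^S$ be the braided category generated in the same way by one object $*$, the morphisms above and two further morphisms $S,S^{-1}: *\to *$, subject to the relations above and $$SS^{-1}=\mathrm{id}_*=S^{-1}S,\qquad \Delta S=(S\otimes S)\tau_{*,*}\Delta,\qquad \varepsilon S=\varepsilon,\qquad \theta_\pm S=\theta_\pm,$$ $$\omega_+(S\otimes\mathrm{id}_*)=\omega_-=\omega_+(\mathrm{id}_*\otimes S),\qquad \omega_+(S^{-1}\otimes\mathrm{id}_*)=\omega_-\tau_{*,*}=\omega_+(\mathrm{id}_*\otimes S^{-1}).$$ Put $\mathcal{D}iag^S=\mathrm{Conv}_{\mathcal{D}^S}(*,\mathbf{1})$.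 The inclusion of the generators induces a braided functor $\mathcal{D}\to\mathcal{D}^S$ and hence a functor $\iota:\mathcal{D}iag\to\mathcal{D}iag^S$, which is the identity on objects. **Theorem.** The functor $\iota:\mathcal{D}iag\to\mathcal{D}iag^S$ is an isomorphism of categories. -/

import Mathlib

open CategoryTheory MonoidalCategory
open scoped MonObj ComonObj

namespace HopfDiagrams

universe v u

/-! ### Free strict braided categories on one object, and their quotients -/

/-- Formal morphisms of the strict braided category with object monoid `(ℕ, +, 0)` (the object `n`
is the `n`-th monoidal power of the generating object `1`) built from the generators `G`.
`comp f g` is "first `f`, then `g`"; `idt` is the identity and `tens` the monoidal product;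
`braid m n` is the braiding
of `m` and `n` and `braidInv m n` is its inverse. -/
inductive BraidTerm (G : ℕ → ℕ → Type) : ℕ → ℕ → Type
  | gen {m n : ℕ} (g : G m n) : BraidTerm G m n
  | idt (n : ℕ) : BraidTerm G n n
  | comp {m n p : ℕ} (f : BraidTerm G m n) (g : BraidTerm G n p) : BraidTerm G m p
  | tens {m n m' n' : ℕ} (f : BraidTerm G m n) (g : BraidTerm G m' n') :
      BraidTerm G (m + m') (n + n')
  | braid (m n : ℕ) : BraidTerm G (m + n) (n + m)
  | braidInv (m n : ℕ) : BraidTerm G (n + m) (m + n)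

namespace BraidTerm

variable {G G' : ℕ → ℕ → Type}

/-- Transport along equalities of objects. -/
def cast {m n m' n' : ℕ} (hm : m = m') (hn : n = n') (f : BraidTerm G m n) : BraidTerm G m' n' :=
  hm ▸ hn ▸ f

/-- Renaming of generators. -/
def map (φ : ∀ {m n : ℕ}, G m n → G' m n) : {m n : ℕ} → BraidTerm G m n → BraidTerm G' m n
  | _, _, gen g => gen (φ g)
  | _, _, idt n => idt n
  | _, _, comp f g => comp (map φ f) (map φ g)
  | _, _, tens f g => tens (map φ f) (map φ g)
  | _, _, braid m n => braid m n
  | _, _, braidInv m n => braidInv m n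

theorem map_cast (φ : ∀ {m n : ℕ}, G m n → G' m n) {m n m' n' : ℕ} (hm : m = m') (hn : n = n')
    (f : BraidTerm G m n) : map φ (cast hm hn f) = cast hm hn (map φ f) := by
  subst hm hn; rfl

end BraidTerm

/-- Generators and relations for a strict braided category generated by one object. -/
structure Presentation where
  /-- generating morphisms -/
  G : ℕ → ℕ → Type
  /-- defining relations -/
  R : ∀ {m n : ℕ}, BraidTerm G m n → BraidTerm G m n → Prop

open BraidTerm in
/-- The congruence (for composition and monoidal product) on formal morphisms generated by the
axioms of strict braided categories together with the relations of the presentation. -/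
inductive Presentation.Eqv (P : Presentation) :
    {m n : ℕ} → BraidTerm P.G m n → BraidTerm P.G m n → Prop
  -- defining relations
  | rel {m n : ℕ} {f g : BraidTerm P.G m n} (h : P.R f g) : P.Eqv f g
  -- congruence
  | refl {m n : ℕ} (f : BraidTerm P.G m n) : P.Eqv f f
  | symm {m n : ℕ} {f g : BraidTerm P.G m n} (h : P.Eqv f g) : P.Eqv g f
  | trans {m n : ℕ} {f g h : BraidTerm P.G m n} (h₁ : P.Eqv f g) (h₂ : P.Eqv g h) : P.Eqv f h
  | comp_congr {m n p : ℕ} {f f' : BraidTerm P.G m n} {g g' : BraidTerm P.G n p}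
      (h₁ : P.Eqv f f') (h₂ : P.Eqv g g') : P.Eqv (comp f g) (comp f' g')
  | tensor_congr {m n m' n' : ℕ} {f f' : BraidTerm P.G m n} {g g' : BraidTerm P.G m' n'}
      (h₁ : P.Eqv f f') (h₂ : P.Eqv g g') : P.Eqv (tens f g) (tens f' g')
  -- category
  | id_comp {m n : ℕ} (f : BraidTerm P.G m n) : P.Eqv (comp (idt m) f) f
  | comp_id {m n : ℕ} (f : BraidTerm P.G m n) : P.Eqv (comp f (idt n)) f
  | assoc {m n p q : ℕ} (f : BraidTerm P.G m n) (g : BraidTerm P.G n p) (h : BraidTerm P.G p q) :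
      P.Eqv (comp (comp f g) h) (comp f (comp g h))
  -- the monoidal product is a functor
  | tensor_id (m n : ℕ) : P.Eqv (tens (idt m) (idt n)) (idt (m + n))
  | tensor_comp {m n p m' n' p' : ℕ} (f : BraidTerm P.G m n) (g : BraidTerm P.G n p)
      (f' : BraidTerm P.G m' n') (g' : BraidTerm P.G n' p') :
      P.Eqv (tens (comp f g) (comp f' g')) (comp (tens f f') (tens g g'))
  -- the monoidal product is strictly associative and strictly unital
  | tensor_assoc {m n m' n' m'' n'' : ℕ} (f : BraidTerm P.G m n) (g : BraidTerm P.G m' n')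
      (h : BraidTerm P.G m'' n'') :
      P.Eqv (cast (Nat.add_assoc m m' m'') (Nat.add_assoc n n' n'') (tens (tens f g) h))
        (tens f (tens g h))
  | id_zero_tensor {m n : ℕ} (f : BraidTerm P.G m n) :
      P.Eqv (cast (Nat.zero_add m) (Nat.zero_add n) (tens (idt 0) f)) f
  | tensor_id_zero {m n : ℕ} (f : BraidTerm P.G m n) : P.Eqv (tens f (idt 0)) f
  -- the braiding is a natural isomorphism
  | braid_braidInv (m n : ℕ) : P.Eqv (comp (braid m n) (braidInv m n)) (idt (m + n))
  | braidInv_braid (m n : ℕ) : P.Eqv (comp (braidInv m n) (braid m n)) (idt (n + m))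
  | braid_naturality {m n m' n' : ℕ} (f : BraidTerm P.G m n) (g : BraidTerm P.G m' n') :
      P.Eqv (comp (tens f g) (braid n n')) (comp (braid m m') (tens g f))
  -- compatibility of the braiding with the monoidal product
  | braid_tensor_right (m n p : ℕ) :
      P.Eqv (cast (Nat.add_assoc m n p).symm (Nat.add_assoc n p m) (braid m (n + p)))
        (comp (tens (braid m n) (idt p))
          (cast (Nat.add_assoc n m p).symm rfl (tens (idt n) (braid m p))))
  | braid_tensor_left (m n p : ℕ) :
      P.Eqv (cast (Nat.add_assoc m n p) (Nat.add_assoc p m n).symm (braid (m + n) p))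
        (comp (tens (idt m) (braid n p))
          (cast (Nat.add_assoc m p n) rfl (tens (braid m p) (idt n))))

/-- Renaming of generators is compatible with the congruences as soon as it carries defining
relations to relations that hold in the target. -/
theorem Presentation.Eqv.map {P Q : Presentation} (φ : ∀ {m n : ℕ}, P.G m n → Q.G m n)
    (hφ : ∀ {m n : ℕ} {f g : BraidTerm P.G m n}, P.R f g → Q.Eqv (f.map φ) (g.map φ))
    {m n : ℕ} {f g : BraidTerm P.G m n} (h : P.Eqv f g) : Q.Eqv (f.map φ) (g.map φ) := by
  induction h with
  | rel h => exact hφ h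
  | refl => exact .refl _
  | symm _ ih => exact .symm ih
  | trans _ _ ih₁ ih₂ => exact .trans ih₁ ih₂
  | comp_congr _ _ ih₁ ih₂ => exact .comp_congr ih₁ ih₂
  | tensor_congr _ _ ih₁ ih₂ => exact .tensor_congr ih₁ ih₂
  | id_comp => exact .id_comp _
  | comp_id => exact .comp_id _
  | assoc => exact .assoc _ _ _
  | tensor_id => exact .tensor_id _ _
  | tensor_comp => exact .tensor_comp _ _ _ _
  | tensor_assoc => rw [BraidTerm.map_cast]; exact .tensor_assoc _ _ _
  | id_zero_tensor => rw [BraidTerm.map_cast]; exact .id_zero_tensor _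
  | tensor_id_zero => exact .tensor_id_zero _
  | braid_braidInv => exact .braid_braidInv _ _
  | braidInv_braid => exact .braidInv_braid _ _
  | braid_naturality => exact .braid_naturality _ _
  | braid_tensor_right m n p =>
      simp only [BraidTerm.map, BraidTerm.map_cast]; exact .braid_tensor_right _ _ _
  | braid_tensor_left m n p =>
      simp only [BraidTerm.map, BraidTerm.map_cast]; exact .braid_tensor_left _ _ _

/-- The strict braided category generated by one object and the generating morphisms `P.G`,
modulo the relations `P.R`: its objects are the natural numbers. -/
@[ext]
structure BrCat (P : Presentation) where
  /-- the exponent of the monoidal power of the generating object -/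
  deg : ℕ

namespace BrCat

variable {P Q : Presentation}

/-- The quotient of formal morphisms by the congruence. -/
def homSetoid (P : Presentation) (m n : ℕ) : Setoid (BraidTerm P.G m n) where
  r := P.Eqv
  iseqv := ⟨.refl, .symm, .trans⟩

instance : Category (BrCat P) where
  Hom X Y := Quotient (homSetoid P X.deg Y.deg)
  id X := Quotient.mk _ (.idt X.deg)
  comp f g := Quotient.map₂ BraidTerm.comp (fun _ _ h₁ _ _ h₂ => .comp_congr h₁ h₂) f g
  id_comp f := by
    induction f using Quotient.inductionOn; exact Quotient.sound (.id_comp _)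
  comp_id f := by
    induction f using Quotient.inductionOn; exact Quotient.sound (.comp_id _)
  assoc f g h := by
    induction f using Quotient.inductionOn
    induction g using Quotient.inductionOn
    induction h using Quotient.inductionOn
    exact Quotient.sound (.assoc _ _ _)

/-- The morphism represented by a formal morphism. -/
def homMk {m n : ℕ} (f : BraidTerm P.G m n) : (⟨m⟩ : BrCat P) ⟶ ⟨n⟩ :=
  Quotient.mk (homSetoid P m n) f

theorem homMk_surj {X Y : BrCat P} (f : X ⟶ Y) :
    ∃ t : BraidTerm P.G X.deg Y.deg, (homMk t : X ⟶ Y) = f :=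
  Quotient.exists_rep f

theorem homMk_eq {m n : ℕ} {f g : BraidTerm P.G m n} (h : P.Eqv f g) :
    (homMk f : (⟨m⟩ : BrCat P) ⟶ ⟨n⟩) = homMk g :=
  Quotient.sound h

theorem homMk_comp {m n p : ℕ} (f : BraidTerm P.G m n) (g : BraidTerm P.G n p) :
    (homMk (.comp f g) : (⟨m⟩ : BrCat P) ⟶ ⟨p⟩) = homMk f ≫ homMk g := rfl

theorem homMk_id (n : ℕ) : (homMk (.idt n) : (⟨n⟩ : BrCat P) ⟶ ⟨n⟩) = 𝟙 _ := rfl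

theorem homMk_cast {m n m' n' : ℕ} (hm : m = m') (hn : n = n') (f : BraidTerm P.G m n) :
    (homMk (f.cast hm hn) : (⟨m'⟩ : BrCat P) ⟶ ⟨n'⟩) =
      eqToHom (by rw [hm]) ≫ homMk f ≫ eqToHom (by rw [hn]) := by
  subst hm hn
  simp [BraidTerm.cast]

/-- The associator and the unitors are identities (along equalities of natural numbers). -/
instance : MonoidalCategoryStruct (BrCat P) where
  tensorObj X Y := ⟨X.deg + Y.deg⟩
  tensorUnit := ⟨0⟩
  tensorHom f g := Quotient.map₂ BraidTerm.tens (fun _ _ h₁ _ _ h₂ => .tensor_congr h₁ h₂) f g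
  whiskerLeft X _ _ f := Quotient.map (BraidTerm.tens (.idt X.deg))
    (fun _ _ h => .tensor_congr (.refl _) h) f
  whiskerRight f Y := Quotient.map (fun t => BraidTerm.tens t (.idt Y.deg))
    (fun _ _ h => .tensor_congr h (.refl _)) f
  associator X Y Z := eqToIso (BrCat.ext (Nat.add_assoc X.deg Y.deg Z.deg))
  leftUnitor X := eqToIso (BrCat.ext (Nat.zero_add X.deg))
  rightUnitor X := eqToIso (BrCat.ext (Nat.add_zero X.deg))

theorem homMk_tensor {m n m' n' : ℕ} (f : BraidTerm P.G m n) (g : BraidTerm P.G m' n') :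
    (homMk (.tens f g) : (⟨m + m'⟩ : BrCat P) ⟶ ⟨n + n'⟩) =
      ((homMk f : (⟨m⟩ : BrCat P) ⟶ ⟨n⟩) ⊗ₘ (homMk g : (⟨m'⟩ : BrCat P) ⟶ ⟨n'⟩)) := rfl

theorem id_tensor_id (X Y : BrCat P) : (𝟙 X ⊗ₘ 𝟙 Y) = 𝟙 (X ⊗ Y) :=
  homMk_eq (.tensor_id X.deg Y.deg)

theorem eqToHom_tensor_id {X X' : BrCat P} (h : X = X') (Y : BrCat P) :
    (eqToHom h ⊗ₘ 𝟙 Y) = eqToHom (by rw [h]) := by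
  subst h; exact id_tensor_id _ _

theorem id_tensor_eqToHom (X : BrCat P) {Y Y' : BrCat P} (h : Y = Y') :
    (𝟙 X ⊗ₘ eqToHom h) = eqToHom (by rw [h]) := by
  subst h; exact id_tensor_id _ _

theorem associator_hom (X Y Z : BrCat P) :
    (α_ X Y Z).hom = eqToHom (BrCat.ext (Nat.add_assoc X.deg Y.deg Z.deg)) := rfl

theorem associator_inv (X Y Z : BrCat P) :
    (α_ X Y Z).inv = eqToHom (BrCat.ext (Nat.add_assoc X.deg Y.deg Z.deg).symm) := rfl

theorem leftUnitor_hom (X : BrCat P) :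
    (λ_ X).hom = eqToHom (BrCat.ext (Nat.zero_add X.deg)) := rfl

theorem rightUnitor_hom (X : BrCat P) :
    (ρ_ X).hom = eqToHom (BrCat.ext (Nat.add_zero X.deg)) := rfl

instance : MonoidalCategory (BrCat P) := MonoidalCategory.ofTensorHom
  (id_tensorHom_id := id_tensor_id)
  (id_tensorHom := fun X _ _ f => by
    obtain ⟨t, rfl⟩ := homMk_surj f; rfl)
  (tensorHom_id := fun f Y => by
    obtain ⟨t, rfl⟩ := homMk_surj f; rfl)
  (tensorHom_comp_tensorHom := fun f₁ f₂ g₁ g₂ => by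
    obtain ⟨t₁, rfl⟩ := homMk_surj f₁
    obtain ⟨t₂, rfl⟩ := homMk_surj f₂
    obtain ⟨s₁, rfl⟩ := homMk_surj g₁
    obtain ⟨s₂, rfl⟩ := homMk_surj g₂
    exact (homMk_eq (.tensor_comp t₁ s₁ t₂ s₂)).symm)
  (associator_naturality := fun f₁ f₂ f₃ => by
    obtain ⟨t₁, rfl⟩ := homMk_surj f₁
    obtain ⟨t₂, rfl⟩ := homMk_surj f₂
    obtain ⟨t₃, rfl⟩ := homMk_surj f₃
    have h := homMk_eq (P := P) (.tensor_assoc t₁ t₂ t₃)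
    rw [homMk_cast, eqToHom_comp_iff] at h
    simp only [associator_hom]
    exact h)
  (leftUnitor_naturality := fun f => by
    obtain ⟨t, rfl⟩ := homMk_surj f
    have h := homMk_eq (P := P) (.id_zero_tensor t)
    rw [homMk_cast, eqToHom_comp_iff] at h
    simp only [leftUnitor_hom]
    exact h)
  (rightUnitor_naturality := fun f => by
    obtain ⟨t, rfl⟩ := homMk_surj f
    have h := homMk_eq (P := P) (.tensor_id_zero t)
    exact (Category.comp_id (homMk _)).trans (h.trans (Category.id_comp (homMk t)).symm))
  (pentagon := fun W X Y Z => by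
    simp only [associator_hom, eqToHom_tensor_id, id_tensor_eqToHom, eqToHom_trans])
  (triangle := fun X Y => by
    simp only [associator_hom, leftUnitor_hom, rightUnitor_hom, eqToHom_tensor_id,
      id_tensor_eqToHom, eqToHom_trans])

instance : BraidedCategory (BrCat P) where
  braiding X Y :=
    { hom := homMk (.braid X.deg Y.deg)
      inv := homMk (.braidInv X.deg Y.deg)
      hom_inv_id := homMk_eq (.braid_braidInv X.deg Y.deg)
      inv_hom_id := homMk_eq (.braidInv_braid X.deg Y.deg) }
  braiding_naturality_right X Y Z f := by
    obtain ⟨t, rfl⟩ := homMk_surj f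
    exact homMk_eq (.braid_naturality (.idt X.deg) t)
  braiding_naturality_left f Z := by
    obtain ⟨t, rfl⟩ := homMk_surj f
    exact homMk_eq (.braid_naturality t (.idt Z.deg))
  hexagon_forward X Y Z := by
    have h := homMk_eq (P := P) (.braid_tensor_right X.deg Y.deg Z.deg)
    rw [homMk_comp, homMk_cast, homMk_cast] at h
    simp only [associator_hom]
    simp only [eqToHom_refl, Category.comp_id] at h
    exact h
  hexagon_reverse X Y Z := by
    have h := homMk_eq (P := P) (.braid_tensor_left X.deg Y.deg Z.deg)
    rw [homMk_comp, homMk_cast, homMk_cast] at h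
    simp only [associator_inv]
    simp only [eqToHom_refl, Category.comp_id] at h
    exact h

/-- The generating object. -/
def star (P : Presentation) : BrCat P := ⟨1⟩

/-- The functor induced by a map of generators which carries defining relations to relations that
hold in the target; it is the identity on objects. -/
def mapFunctor (φ : ∀ {m n : ℕ}, P.G m n → Q.G m n)
    (hφ : ∀ {m n : ℕ} {f g : BraidTerm P.G m n}, P.R f g → Q.Eqv (f.map φ) (g.map φ)) :
    BrCat P ⥤ BrCat Q where
  obj X := ⟨X.deg⟩
  map f := Quotient.map (BraidTerm.map φ) (fun _ _ h => Presentation.Eqv.map φ hφ h) f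
  map_id _ := rfl
  map_comp f g := by
    obtain ⟨t, rfl⟩ := homMk_surj f
    obtain ⟨s, rfl⟩ := homMk_surj g
    rfl

end BrCat

/-! ### Convolution categories -/

section Convolution

variable {𝒞 : Type u} [Category.{v} 𝒞] [MonoidalCategory 𝒞]

/-- The monoidal power `C ⊗ ⋯ ⊗ C` (`n` factors). -/
def tpow (C : 𝒞) : ℕ → 𝒞
  | 0 => 𝟙_ 𝒞
  | n + 1 => tpow C n ⊗ C

/-- The coalgebra structure of the monoidal powers of a coalgebra in a braided category. -/
instance tpowComonObj [BraidedCategory 𝒞] (C : 𝒞) [ComonObj C] : ∀ n : ℕ, ComonObj (tpow C n)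
  | 0 => ComonObj.instTensorUnit 𝒞
  | n + 1 =>
    letI := tpowComonObj C n
    inferInstanceAs (ComonObj (tpow C n ⊗ C))

/-- The objects of the convolution category of a coalgebra `C` and an algebra `A`: the natural
numbers. -/
@[ext]
structure ConvCat (C A : 𝒞) where
  /-- the underlying natural number -/
  deg : ℕ

namespace ConvCat

/-- The morphisms from `m` to `n`: there are none unless `m = n`, in which case they are the
morphisms from the `n`-th monoidal power of `C` to `A`. -/
@[ext]
structure Hom {C A : 𝒞} (m n : ConvCat C A) where
  /-- source and target agree -/
  eq : m.deg = n.deg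
  /-- the underlying morphism -/
  val : Conv (tpow C m.deg) A

variable {C A : 𝒞}

/-- Transport of a morphism along an equality of exponents. -/
def transport {m n : ℕ} (h : m = n) (g : Conv (tpow C n) A) : Conv (tpow C m) A :=
  eqToHom (congrArg (tpow C) h) ≫ (show tpow C n ⟶ A from g)

theorem transport_rfl {n : ℕ} (g : Conv (tpow C n) A) : transport rfl g = g :=
  Category.id_comp (show tpow C n ⟶ A from g)

variable [BraidedCategory 𝒞] [ComonObj C] [MonObj A]

/-- The composite `g ∘ f` (that is, `f ≫ g`) is the convolution product `g ⋆ f`. -/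
def Hom.comp {m n p : ConvCat C A} (f : Hom m n) (g : Hom n p) : Hom m p where
  eq := f.eq.trans g.eq
  val := transport f.eq g.val * f.val

theorem Hom.comp_val {n p : ConvCat C A} (f : Hom n n) (g : Hom n p) :
    (f.comp g).val = g.val * f.val := by
  rw [Hom.comp, transport_rfl]

instance : Category (ConvCat C A) where
  Hom := Hom
  id n := ⟨rfl, 1⟩
  comp := Hom.comp
  id_comp {m n} f := by
    apply Hom.ext
    rw [Hom.comp_val]
    exact mul_one _
  comp_id {m n} f := by
    obtain ⟨m⟩ := m; obtain ⟨n⟩ := n; obtain ⟨h, f⟩ := f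
    change m = n at h
    subst h
    apply Hom.ext
    rw [Hom.comp_val]
    exact one_mul _
  assoc {m n p q} f g h := by
    obtain ⟨m⟩ := m; obtain ⟨n⟩ := n; obtain ⟨p⟩ := p
    obtain ⟨hf, f⟩ := f; obtain ⟨hg, g⟩ := g
    change m = n at hf
    change n = p at hg
    subst hf hg
    apply Hom.ext
    simp only [Hom.comp_val]
    exact (mul_assoc _ _ _).symm

end ConvCat

end Convolution

/-! ### Hopf diagrams without antipode -/

/-- The generating morphisms of Hopf diagrams without antipode. -/
inductive HopfGen : ℕ → ℕ → Type
  | comul : HopfGen 1 2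
  | counit : HopfGen 1 0
  | omegaPos : HopfGen 2 0
  | omegaNeg : HopfGen 2 0
  | thetaPos : HopfGen 1 0
  | thetaNeg : HopfGen 1 0

open BraidTerm in
/-- Coassociativity and counitality of the coproduct. -/
inductive HopfRel : {m n : ℕ} → BraidTerm HopfGen m n → BraidTerm HopfGen m n → Prop
  | coassoc : HopfRel (m := 1) (n := 3)
      (comp (gen HopfGen.comul) (tens (idt 1) (gen HopfGen.comul)))
      (comp (gen HopfGen.comul) (tens (gen HopfGen.comul) (idt 1)))
  | id_counit : HopfRel (m := 1) (n := 1)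
      (comp (gen HopfGen.comul) (tens (idt 1) (gen HopfGen.counit))) (idt 1)
  | counit_id : HopfRel (m := 1) (n := 1)
      (comp (gen HopfGen.comul) (tens (gen HopfGen.counit) (idt 1))) (idt 1)

/-- The presentation of the braided category of Hopf diagrams without antipode. -/
abbrev hopf : Presentation := ⟨HopfGen, HopfRel⟩

/-! ### Hopf diagrams with antipode -/

/-- The generating morphisms of Hopf diagrams with antipode: those of `HopfGen`, the antipode and
its inverse. -/
inductive HopfGenS : ℕ → ℕ → Type
  | base {m n : ℕ} (g : HopfGen m n) : HopfGenS m n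
  | S : HopfGenS 1 1
  | Sinv : HopfGenS 1 1

open BraidTerm HopfGen HopfGenS in
/-- The relations of Hopf diagrams with antipode. -/
inductive HopfRelS : {m n : ℕ} → BraidTerm HopfGenS m n → BraidTerm HopfGenS m n → Prop
  -- coassociativity and counitality
  | base {m n : ℕ} {f g : BraidTerm HopfGen m n} (h : HopfRel f g) :
      HopfRelS (f.map HopfGenS.base) (g.map HopfGenS.base)
  -- `S S⁻¹ = id = S⁻¹ S`
  | Sinv_S : HopfRelS (comp (gen Sinv) (gen S)) (idt 1)
  | S_Sinv : HopfRelS (comp (gen S) (gen Sinv)) (idt 1)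
  -- `Δ S = (S ⊗ S) τ Δ`
  | S_comul : HopfRelS (m := 1) (n := 2) (comp (gen S) (gen (base comul)))
      (comp (gen (base comul)) (comp (braid 1 1) (tens (gen S) (gen S))))
  -- `ε S = ε`
  | S_counit : HopfRelS (comp (gen S) (gen (base counit))) (gen (base counit))
  -- `θ_± S = θ_±`
  | S_thetaPos : HopfRelS (comp (gen S) (gen (base thetaPos))) (gen (base thetaPos))
  | S_thetaNeg : HopfRelS (comp (gen S) (gen (base thetaNeg))) (gen (base thetaNeg))
  -- `ω_+ (S ⊗ id) = ω_- = ω_+ (id ⊗ S)`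
  | S_id_omegaPos : HopfRelS (m := 2) (n := 0)
      (comp (tens (gen S) (idt 1)) (gen (base omegaPos))) (gen (base omegaNeg))
  | id_S_omegaPos : HopfRelS (m := 2) (n := 0)
      (comp (tens (idt 1) (gen S)) (gen (base omegaPos))) (gen (base omegaNeg))
  -- `ω_+ (S⁻¹ ⊗ id) = ω_- τ = ω_+ (id ⊗ S⁻¹)`
  | Sinv_id_omegaPos : HopfRelS (m := 2) (n := 0)
      (comp (tens (gen Sinv) (idt 1)) (gen (base omegaPos)))
      (comp (braid 1 1) (gen (base omegaNeg)))
  | id_Sinv_omegaPos : HopfRelS (m := 2) (n := 0)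
      (comp (tens (idt 1) (gen Sinv)) (gen (base omegaPos)))
      (comp (braid 1 1) (gen (base omegaNeg)))

/-- The presentation of the braided category of Hopf diagrams with antipode. -/
abbrev hopfS : Presentation := ⟨HopfGenS, HopfRelS⟩

/-- The functor induced by the inclusion of the generators without antipode. -/
def inclusion : BrCat hopf ⥤ BrCat hopfS :=
  BrCat.mapFunctor HopfGenS.base (fun h => .rel (.base h))

/-! ### The categories of Hopf diagrams -/

namespace BrCat

/-- A pair of formal morphisms satisfying coassociativity and counitality makes the generating
object into a coalgebra. -/
@[reducible] def comonObjStar (P : Presentation) (d : BraidTerm P.G 1 2) (e : BraidTerm P.G 1 0)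
    (h₁ : P.Eqv (m := 1) (n := 3) (.comp d (.tens (.idt 1) d)) (.comp d (.tens d (.idt 1))))
    (h₂ : P.Eqv (m := 1) (n := 1) (.comp d (.tens (.idt 1) e)) (.idt 1))
    (h₃ : P.Eqv (m := 1) (n := 1) (.comp d (.tens e (.idt 1))) (.idt 1)) :
    ComonObj (star P) where
  counit := homMk e
  comul := homMk d
  counit_comul := homMk_eq h₃
  comul_counit := homMk_eq h₂
  comul_assoc := (homMk_eq h₁).trans (congrArg (fun t : (⟨2⟩ : BrCat P) ⟶ ⟨3⟩ => homMk d ≫ t)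
    (Category.comp_id (homMk (.tens d (.idt 1)) : (⟨2⟩ : BrCat P) ⟶ ⟨3⟩)).symm)

end BrCat

instance : ComonObj (BrCat.star hopf) :=
  BrCat.comonObjStar hopf (.gen .comul) (.gen .counit)
    (.rel .coassoc) (.rel .id_counit) (.rel .counit_id)

instance : ComonObj (BrCat.star hopfS) :=
  BrCat.comonObjStar hopfS (.gen (.base .comul)) (.gen (.base .counit))
    (.rel (.base .coassoc)) (.rel (.base .id_counit)) (.rel (.base .counit_id))

/-- The category of Hopf diagrams without antipode: the convolution category of the coalgebra
`star` and the trivial algebra `𝟙_`. -/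
abbrev Diag : Type := ConvCat (BrCat.star hopf) (𝟙_ (BrCat hopf))

/-- The category of Hopf diagrams with antipode. -/
abbrev DiagS : Type := ConvCat (BrCat.star hopfS) (𝟙_ (BrCat hopfS))

namespace BrCat

theorem inclusion_map_tensor {X Y X' Y' : BrCat hopf} (f : X ⟶ Y) (g : X' ⟶ Y') :
    inclusion.map (f ⊗ₘ g) = (inclusion.map f ⊗ₘ inclusion.map g) := by
  obtain ⟨t, rfl⟩ := homMk_surj f
  obtain ⟨s, rfl⟩ := homMk_surj g
  rfl

theorem inclusion_map_tensorμ (X Y Z W : BrCat hopf) :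
    inclusion.map (tensorμ X Y Z W) =
      tensorμ (inclusion.obj X) (inclusion.obj Y) (inclusion.obj Z) (inclusion.obj W) := by
  have hβ : inclusion.map (β_ Y Z).hom = (β_ (inclusion.obj Y) (inclusion.obj Z)).hom := rfl
  simp only [tensorμ, ← id_tensorHom, ← tensorHom_id, Functor.map_comp, inclusion_map_tensor,
    associator_hom, associator_inv, eqToHom_map, hβ]
  rfl

/-- A coalgebra structure on `X` without antipode and one on `X'` with antipode correspond to each
other under the inclusion. -/
structure Compat (X : BrCat hopf) (X' : BrCat hopfS) [ComonObj X] [ComonObj X'] : Prop where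
  obj : X' = inclusion.obj X
  counit : ε[X'] = eqToHom obj ≫ inclusion.map ε[X]
  comul : Δ[X'] ≫ (eqToHom obj ⊗ₘ eqToHom obj) = eqToHom obj ≫ inclusion.map Δ[X]

theorem compat_unit :
    letI := ComonObj.instTensorUnit (BrCat hopf)
    letI := ComonObj.instTensorUnit (BrCat hopfS)
    Compat (𝟙_ (BrCat hopf)) (𝟙_ (BrCat hopfS)) := by
  let := ComonObj.instTensorUnit (BrCat hopf)
  let := ComonObj.instTensorUnit (BrCat hopfS)
  refine ⟨rfl, ?_, ?_⟩
  · exact (Category.id_comp _).symm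
  · exact (congrArg (Δ[𝟙_ (BrCat hopfS)] ≫ ·) (id_tensor_id _ _)).trans
      ((Category.comp_id _).trans (Category.id_comp _).symm)

theorem compat_star : Compat (star hopf) (star hopfS) := by
  refine ⟨rfl, ?_, ?_⟩
  · exact (Category.id_comp _).symm
  · exact (congrArg (Δ[star hopfS] ≫ ·) (id_tensor_id _ _)).trans
      ((Category.comp_id _).trans (Category.id_comp _).symm)

/-- If the object of `X'` is literally that of `X`, no transport is needed. -/
theorem compat_iff (X : BrCat hopf) [ComonObj X] [ComonObj (inclusion.obj X)] :
    Compat X (inclusion.obj X) ↔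
      ε[inclusion.obj X] = inclusion.map ε[X] ∧ Δ[inclusion.obj X] = inclusion.map Δ[X] := by
  have e : (𝟙 (inclusion.obj X) ⊗ₘ 𝟙 (inclusion.obj X)) = 𝟙 _ := id_tensor_id _ _
  have e₂ : Δ[inclusion.obj X] ≫ (𝟙 (inclusion.obj X) ⊗ₘ 𝟙 (inclusion.obj X)) =
      Δ[inclusion.obj X] := (congrArg (Δ[inclusion.obj X] ≫ ·) e).trans (Category.comp_id _)
  constructor
  · rintro ⟨_, h₁, h₂⟩
    exact ⟨h₁.trans (Category.id_comp _), e₂.symm.trans (h₂.trans (Category.id_comp _))⟩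
  · rintro ⟨h₁, h₂⟩
    exact ⟨rfl, h₁.trans (Category.id_comp _).symm,
      e₂.trans (h₂.trans (Category.id_comp _).symm)⟩

theorem Compat.tensor {X Y : BrCat hopf} {X' Y' : BrCat hopfS} [ComonObj X] [ComonObj Y]
    [ComonObj X'] [ComonObj Y'] (hX : Compat X X') (hY : Compat Y Y') :
    Compat (X ⊗ Y) (X' ⊗ Y') := by
  obtain rfl := hX.obj
  obtain rfl := hY.obj
  rw [compat_iff] at hX hY
  let : ComonObj (inclusion.obj (X ⊗ Y)) :=
    inferInstanceAs (ComonObj (inclusion.obj X ⊗ inclusion.obj Y))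
  refine (compat_iff (X ⊗ Y)).2 ⟨?_, ?_⟩
  · rw [Comon.tensorObj_counit, Functor.map_comp, inclusion_map_tensor, ← hX.1, ← hY.1]
    exact Comon.tensorObj_counit _ _
  · rw [Comon.tensorObj_comul, Functor.map_comp, inclusion_map_tensor, inclusion_map_tensorμ,
      ← hX.2, ← hY.2]
    exact Comon.tensorObj_comul _ _

theorem compat_tpow : ∀ n : ℕ, Compat (tpow (star hopf) n) (tpow (star hopfS) n)
  | 0 => compat_unit
  | n + 1 => (compat_tpow n).tensor compat_star

theorem Compat.map_one {X : BrCat hopf} {X' : BrCat hopfS} [ComonObj X] [ComonObj X']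
    (h : Compat X X') :
    eqToHom h.obj ≫ inclusion.map (1 : Conv X (𝟙_ (BrCat hopf))) =
      (1 : Conv X' (𝟙_ (BrCat hopfS))) := by
  obtain rfl := h.obj
  rw [compat_iff] at h
  refine (Category.id_comp _).trans ?_
  rw [Conv.one_eq, Conv.one_eq, Functor.map_comp, h.1]
  rfl

theorem Compat.map_mul {X : BrCat hopf} {X' : BrCat hopfS} [ComonObj X] [ComonObj X']
    (h : Compat X X') (f g : Conv X (𝟙_ (BrCat hopf))) :
    eqToHom h.obj ≫ inclusion.map (f * g : Conv X (𝟙_ (BrCat hopf))) =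
      ((show Conv X' (𝟙_ (BrCat hopfS)) from eqToHom h.obj ≫ inclusion.map f) *
        (show Conv X' (𝟙_ (BrCat hopfS)) from eqToHom h.obj ≫ inclusion.map g) :
        Conv X' (𝟙_ (BrCat hopfS))) := by
  obtain rfl := h.obj
  rw [compat_iff] at h
  refine (Category.id_comp _).trans (Eq.trans ?_ (congrArg₂
    (fun a b : Conv (inclusion.obj X) (𝟙_ (BrCat hopfS)) => a * b)
    (Category.id_comp (inclusion.map f)).symm (Category.id_comp (inclusion.map g)).symm))
  obtain ⟨s, rfl⟩ := homMk_surj (show X ⟶ 𝟙_ (BrCat hopf) from f)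
  obtain ⟨t, rfl⟩ := homMk_surj (show X ⟶ 𝟙_ (BrCat hopf) from g)
  change inclusion.map (Δ[X] ≫ _) = Δ[inclusion.obj X] ≫ _
  rw [h.2, Functor.map_comp]
  rfl

end BrCat

/-- The functor from Hopf diagrams without antipode to Hopf diagrams with antipode induced by the
inclusion of generators. It is the identity on objects. (Monoidal powers of `star` with and without
antipode are the same natural number, so the `eqToHom` below is an identity.) -/
def iota : Diag ⥤ DiagS where
  obj n := ⟨n.deg⟩
  map {m _} f := ⟨f.eq, eqToHom (BrCat.compat_tpow m.deg).obj ≫ inclusion.map f.val⟩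
  map_id n := ConvCat.Hom.ext ((BrCat.compat_tpow n.deg).map_one)
  map_comp {m n p} f g := by
    obtain ⟨m⟩ := m; obtain ⟨n⟩ := n; obtain ⟨p⟩ := p
    obtain ⟨hf, f⟩ := f
    change m = n at hf
    subst hf
    apply ConvCat.Hom.ext
    refine (congrArg (fun t => eqToHom _ ≫ inclusion.map t)
      (ConvCat.Hom.comp_val (⟨rfl, f⟩ : ConvCat.Hom ⟨m⟩ ⟨m⟩) g)).trans ?_
    refine ((BrCat.compat_tpow m).map_mul g.val f).trans ?_
    let F (q : ℕ) (k : ConvCat.Hom (C := BrCat.star hopf) (A := 𝟙_ (BrCat hopf)) ⟨m⟩ ⟨q⟩) :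
        ConvCat.Hom (C := BrCat.star hopfS) (A := 𝟙_ (BrCat hopfS)) ⟨m⟩ ⟨q⟩ :=
      ⟨k.eq, eqToHom (BrCat.compat_tpow m).obj ≫ inclusion.map k.val⟩
    exact (ConvCat.Hom.comp_val (F m ⟨rfl, f⟩) (F p g)).symm

end HopfDiagrams

/-!
On each endomorphism set, `iota` is the map `Hom(*ⁿ, 𝟙) → Hom(*ⁿ, 𝟙)` given by the inclusion of
Hopf diagrams without antipode, so it suffices that this map is bijective. The reason is that the
relations let every power of the antipode slide from the inputs of a diagram to its outputs, and
that there are no outputs when the target is the unit.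

For integers `k` at the inputs of a diagram `t : m → n`, the recursion on `t` given by `twist` and
`out` describes the result of the sliding: `Sᵏ` followed by `t` equals the antipode-free diagram
`twist t k` followed by `S` to the powers `out t k` (`antipodePow_comp`). A power `Sᵏ` turns `Δ`
into `Δ` followed by `τᵏ` (a `k`-fold half twist of the two strands), is absorbed by `ε` and `θ_±`,
and shifts `ω_+` along the sequence `…, ω_+, ω_-, ω_+ τ⁻¹, ω_- τ⁻¹, …` (`omegaPow`). This gives
surjectivity.

For injectivity, `twist` has to respect the congruences (`twist_eqv`). The structural axioms are
respected because `k ↦ (twist t k, out t k)` defines morphisms of a braided category in which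
exponents are simply carried along. The relations involving `S` hold by construction, and
coassociativity and counitality amount to `Δ` followed by `τᵏ` being again a coproduct
(`IsComul.comp_braiding_zpow`), which for coassociativity is the Yang–Baxter equation. Since `twist`
with zero exponents is the identity on diagrams without antipode (`twist_map_base`), it is a left
inverse of the inclusion.
-/

namespace HopfDiagrams

/-! ### Integer powers of invertible formal morphisms -/

namespace BraidTerm

variable {G : ℕ → ℕ → Type}

/-- The integer power `t ^ k` of a formal endomorphism `t` with formal inverse `t'`. -/
def zpow {n : ℕ} (t t' : BraidTerm G n n) : ℤ → BraidTerm G n n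
  | .ofNat k => k.rec (idt n) fun _ s => comp s t
  | .negSucc k => k.rec t' fun _ s => comp s t'

end BraidTerm

namespace BrCat

variable {P : Presentation} {n : ℕ}

theorem homMk_eq_iff {m n : ℕ} {f g : BraidTerm P.G m n} :
    (homMk f : (⟨m⟩ : BrCat P) ⟶ ⟨n⟩) = homMk g ↔ P.Eqv f g :=
  ⟨fun h => Quotient.exact h, homMk_eq⟩

/-- The automorphism represented by a formal morphism and a formal inverse of it. -/
def autMk (t t' : BraidTerm P.G n n) (h : P.Eqv (.comp t t') (.idt n))
    (h' : P.Eqv (.comp t' t) (.idt n)) : Aut (⟨n⟩ : BrCat P) :=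
  ⟨homMk t, homMk t', homMk_eq h, homMk_eq h'⟩

theorem homMk_zpow (t t' : BraidTerm P.G n n) (h : P.Eqv (.comp t t') (.idt n))
    (h' : P.Eqv (.comp t' t) (.idt n)) (k : ℤ) :
    (homMk (.zpow t t' k) : (⟨n⟩ : BrCat P) ⟶ ⟨n⟩) = (autMk t t' h h' ^ k).hom := by
  cases k with
  | ofNat k =>
    induction k with
    | zero => rfl
    | succ k ih =>
      refine (congrArg (· ≫ homMk t) ih).trans ?_
      rw [Int.ofNat_eq_natCast, Int.ofNat_eq_natCast, zpow_natCast, zpow_natCast, pow_succ']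
      rfl
  | negSucc k =>
    induction k with
    | zero => rw [zpow_negSucc, zero_add, pow_one]; rfl
    | succ k ih =>
      refine (congrArg (· ≫ homMk t') ih).trans ?_
      rw [zpow_negSucc, zpow_negSucc, ← inv_pow, ← inv_pow, pow_succ' _ (k + 1)]
      rfl

end BrCat

/-! ### Coalgebras twisted by powers of the braiding -/

section Twist

universe v u

variable {𝒞 : Type u} [Category.{v} 𝒞] [MonoidalCategory 𝒞]

/-- The morphism `d` is a coproduct on `X` with counit `e`. -/
structure IsComul (X : 𝒞) (d : X ⟶ X ⊗ X) (e : X ⟶ 𝟙_ 𝒞) : Prop where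
  counit_left : d ≫ e ▷ X = (λ_ X).inv
  counit_right : d ≫ X ◁ e = (ρ_ X).inv
  coassoc : d ≫ X ◁ d = d ≫ d ▷ X ≫ (α_ X X X).hom

variable {X : 𝒞} {d : X ⟶ X ⊗ X} {e : X ⟶ 𝟙_ 𝒞}

/-- The opposite of a coproduct is a coproduct. Both iterated coproducts end in a positive half
twist on three strands, so that coassociativity is the Yang–Baxter equation. -/
theorem IsComul.comp_braiding_hom [BraidedCategory 𝒞] (h : IsComul X d e) :
    IsComul X (d ≫ (β_ X X).hom) e where
  counit_left := by
    rw [Category.assoc, ← BraidedCategory.braiding_naturality_right, ← Category.assoc,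
      h.counit_right]
    simp
  counit_right := by
    rw [Category.assoc, ← BraidedCategory.braiding_naturality_left, ← Category.assoc,
      h.counit_left]
    simp
  coassoc := by
    have h₁ : (d ≫ (β_ X X).hom) ≫ X ◁ d = (d ≫ d ▷ X) ≫ (β_ (X ⊗ X) X).hom := by
      rw [Category.assoc, ← BraidedCategory.braiding_naturality_left, Category.assoc]
    have h₂ : (d ≫ (β_ X X).hom) ≫ d ▷ X = (d ≫ X ◁ d) ≫ (β_ X (X ⊗ X)).hom := by
      rw [Category.assoc, ← BraidedCategory.braiding_naturality_right, Category.assoc]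
    have yb := BraidedCategory.yang_baxter X X X
    rw [MonoidalCategory.whiskerLeft_comp, MonoidalCategory.comp_whiskerRight,
      Category.assoc _ _ (α_ X X X).hom, ← Category.assoc _ (X ◁ d), ← Category.assoc _ (d ▷ X),
      h₁, h₂, h.coassoc, BraidedCategory.braiding_tensor_left_hom,
      BraidedCategory.braiding_tensor_right_hom]
    simp only [Category.assoc, Iso.hom_inv_id_assoc] at yb ⊢
    rw [← yb]
    simp

theorem IsComul.comp_braiding_inv [BraidedCategory 𝒞] (h : IsComul X d e) :
    IsComul X (d ≫ (β_ X X).inv) e :=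
  letI := reverseBraiding 𝒞
  h.comp_braiding_hom

theorem IsComul.comp_braiding_zpow [BraidedCategory 𝒞] (h : IsComul X d e) (u : Aut (X ⊗ X))
    (hu : u.hom = (β_ X X).hom) (k : ℤ) : IsComul X (d ≫ (u ^ k).hom) e := by
  have hu' : u⁻¹.hom = (β_ X X).inv := Iso.inv_eq_inv u (β_ X X) |>.2 hu
  induction k using Int.induction_on with
  | zero => rw [zpow_zero]; exact (Category.comp_id d).symm ▸ h
  | succ k ih =>
    have := ih.comp_braiding_hom
    rw [← hu] at this
    rw [add_comm, zpow_one_add]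
    exact Category.assoc d _ _ ▸ this
  | pred k ih =>
    have := ih.comp_braiding_inv
    rw [← hu'] at this
    rw [sub_eq_neg_add, zpow_add, zpow_neg_one]
    exact Category.assoc d _ _ ▸ this

end Twist

/-! ### Moving antipodes from the inputs to the outputs -/

namespace BraidTerm

/-- `ω_+` precomposed with `j` antipodes, on either input: the pattern is
`…, ω_+, ω_-, ω_+ τ⁻¹, ω_- τ⁻¹, …`, starting with `ω_+` at `j = 0`. Integer division and remainder
round down, so that the formula is uniform for negative `j`. -/
def omegaPow (j : ℤ) : BraidTerm HopfGen 2 0 :=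
  comp (zpow (braid 1 1) (braidInv 1 1) (-(j / 2)))
    (if j % 2 = 0 then gen .omegaPos else gen .omegaNeg)

/-- The exponents of the antipode at the outputs of a generator, given those at its inputs. -/
def genOut : {m n : ℕ} → HopfGenS m n → (Fin m → ℤ) → Fin n → ℤ
  | _, _, .base .comul, k => fun _ => k 0
  | _, _, .base .counit, _ => Fin.elim0
  | _, _, .base .omegaPos, _ => Fin.elim0
  | _, _, .base .omegaNeg, _ => Fin.elim0
  | _, _, .base .thetaPos, _ => Fin.elim0
  | _, _, .base .thetaNeg, _ => Fin.elim0
  | _, _, .S, k => fun i => k i + 1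
  | _, _, .Sinv, k => fun i => k i - 1

/-- What remains of a generator after the powers of the antipode at its inputs have been moved
to its outputs. -/
def genTwist : {m n : ℕ} → HopfGenS m n → (Fin m → ℤ) → BraidTerm HopfGen m n
  | _, _, .base .comul, k => comp (gen .comul) (zpow (braid 1 1) (braidInv 1 1) (k 0))
  | _, _, .base .counit, _ => gen .counit
  | _, _, .base .omegaPos, k => omegaPow (k 0 + k 1)
  | _, _, .base .omegaNeg, k => omegaPow (k 0 + k 1 + 1)
  | _, _, .base .thetaPos, _ => gen .thetaPos
  | _, _, .base .thetaNeg, _ => gen .thetaNeg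
  | _, _, .S, _ => idt 1
  | _, _, .Sinv, _ => idt 1

/-- The exponents on the first inputs. -/
def left {m m' : ℕ} (k : Fin (m + m') → ℤ) : Fin m → ℤ := fun i => k (Fin.castAdd m' i)

/-- The exponents on the last inputs. -/
def right {m m' : ℕ} (k : Fin (m + m') → ℤ) : Fin m' → ℤ := fun i => k (Fin.natAdd m i)

/-- The exponents of the antipode at the outputs of a formal morphism `t`, given the exponents `k`
at its inputs, when all antipodes are moved to the outputs. -/
def out : {m n : ℕ} → BraidTerm HopfGenS m n → (Fin m → ℤ) → Fin n → ℤ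
  | _, _, gen g, k => genOut g k
  | _, _, idt _, k => k
  | _, _, comp f g, k => out g (out f k)
  | _, _, tens f g, k => Fin.append (out f (left k)) (out g (right k))
  | _, _, braid _ _, k => Fin.append (right k) (left k)
  | _, _, braidInv _ _, k => Fin.append (right k) (left k)

/-- The antipode-free formal morphism that remains of `t`, with powers `k` of the antipode at its
inputs, when all antipodes are moved to the outputs. -/
def twist : {m n : ℕ} → BraidTerm HopfGenS m n → (Fin m → ℤ) → BraidTerm HopfGen m n
  | _, _, gen g, k => genTwist g k
  | _, _, idt n, _ => idt n
  | _, _, comp f g, k => comp (twist f k) (twist g (out f k))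
  | _, _, tens f g, k => tens (twist f (left k)) (twist g (right k))
  | _, _, braid m n, _ => braid m n
  | _, _, braidInv m n, _ => braidInv m n

theorem out_cast {m n m' n' : ℕ} (hm : m = m') (hn : n = n') (f : BraidTerm HopfGenS m n)
    (k : Fin m' → ℤ) : out (cast hm hn f) k = fun i => out f (fun j => k (j.cast hm))
      (i.cast hn.symm) := by
  subst hm hn; rfl

theorem twist_cast {m n m' n' : ℕ} (hm : m = m') (hn : n = n') (f : BraidTerm HopfGenS m n)
    (k : Fin m' → ℤ) :
    twist (cast hm hn f) k = cast hm hn (twist f fun j => k (j.cast hm)) := by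
  subst hm hn; rfl

@[simp]
theorem left_append {m m' : ℕ} (k : Fin m → ℤ) (l : Fin m' → ℤ) : left (Fin.append k l) = k :=
  funext fun i => Fin.append_left k l i

@[simp]
theorem right_append {m m' : ℕ} (k : Fin m → ℤ) (l : Fin m' → ℤ) : right (Fin.append k l) = l :=
  funext fun i => Fin.append_right k l i

@[simp]
theorem append_left_right {m m' : ℕ} (k : Fin (m + m') → ℤ) : Fin.append (left k) (right k) = k :=
  Fin.append_castAdd_natAdd

theorem append_apply {m n : ℕ} (k : Fin m → ℤ) (l : Fin n → ℤ) (i : Fin (m + n)) :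
    Fin.append k l i = if h : i < m then k ⟨i, h⟩ else l ⟨i - m, by omega⟩ := by
  refine Fin.addCases (fun i => ?_) (fun i => ?_) i <;> simp

theorem left_left {m m' m'' : ℕ} (k : Fin (m + (m' + m'')) → ℤ) :
    left (left fun j : Fin (m + m' + m'') => k (j.cast (Nat.add_assoc m m' m''))) = left k := rfl

theorem right_left {m m' m'' : ℕ} (k : Fin (m + (m' + m'')) → ℤ) :
    right (left fun j : Fin (m + m' + m'') => k (j.cast (Nat.add_assoc m m' m''))) =
      left (right k) := rfl

theorem right_cast {m m' m'' : ℕ} (k : Fin (m + (m' + m'')) → ℤ) :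
    right (fun j : Fin (m + m' + m'') => k (j.cast (Nat.add_assoc m m' m''))) =
      right (right k) :=
  funext fun i => congrArg k (Fin.ext (Nat.add_assoc m m' i))

end BraidTerm

open BraidTerm

variable {P : Presentation}

theorem Presentation.Eqv.zpow_add_one {n : ℕ} {t t' : BraidTerm P.G n n}
    (h : P.Eqv (.comp t t') (.idt n)) (h' : P.Eqv (.comp t' t) (.idt n)) (k : ℤ) :
    P.Eqv (zpow t t' (k + 1)) (comp (zpow t t' k) t) := by
  rw [← BrCat.homMk_eq_iff, BrCat.homMk_comp, BrCat.homMk_zpow t t' h h',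
    BrCat.homMk_zpow t t' h h', add_comm, zpow_one_add]
  rfl

theorem Presentation.Eqv.zpow_one_add {n : ℕ} {t t' : BraidTerm P.G n n}
    (h : P.Eqv (.comp t t') (.idt n)) (h' : P.Eqv (.comp t' t) (.idt n)) (k : ℤ) :
    P.Eqv (zpow t t' (k + 1)) (comp t (zpow t t' k)) := by
  rw [← BrCat.homMk_eq_iff, BrCat.homMk_comp, BrCat.homMk_zpow t t' h h',
    BrCat.homMk_zpow t t' h h', _root_.zpow_add_one]
  rfl

theorem braid_zpow_succ (k : ℤ) : P.Eqv (zpow (braid 1 1) (braidInv 1 1) (k + 1))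
    (comp (zpow (braid 1 1) (braidInv 1 1) k) (braid 1 1)) :=
  .zpow_add_one (.braid_braidInv 1 1) (.braidInv_braid 1 1) k

theorem braid_zpow_succ' (k : ℤ) : P.Eqv (zpow (braid 1 1) (braidInv 1 1) (k + 1))
    (comp (braid 1 1) (zpow (braid 1 1) (braidInv 1 1) k)) :=
  .zpow_one_add (.braid_braidInv 1 1) (.braidInv_braid 1 1) k

theorem omegaPow_zero : hopf.Eqv (omegaPow 0) (gen .omegaPos) := .id_comp _

theorem omegaPow_one : hopf.Eqv (omegaPow 1) (gen .omegaNeg) := .id_comp _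

theorem braid_omegaPow (j : ℤ) : hopf.Eqv (comp (braid 1 1) (omegaPow (j + 2))) (omegaPow j) := by
  have h₁ : (j + 2) % 2 = j % 2 := by omega
  have h₂ : -(j / 2) = -((j + 2) / 2) + 1 := by omega
  refine .trans (.symm (.assoc _ _ _)) ?_
  rw [omegaPow, h₂, h₁]
  exact .comp_congr (.symm (braid_zpow_succ' _)) (.refl _)

theorem isComul_star : IsComul (BrCat.star hopf) (BrCat.homMk (gen .comul))
    (BrCat.homMk (gen .counit)) where
  counit_left := BrCat.homMk_eq (.rel .counit_id)
  counit_right := BrCat.homMk_eq (.rel .id_counit)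
  coassoc := ComonObj.comul_assoc (BrCat.star hopf)

theorem isComul_twist (k : ℤ) : IsComul (BrCat.star hopf)
    (BrCat.homMk (comp (gen .comul) (zpow (braid 1 1) (braidInv 1 1) k)))
    (BrCat.homMk (gen .counit)) := by
  have e := BrCat.homMk_zpow (P := hopf) _ _ (.braid_braidInv 1 1) (.braidInv_braid 1 1) k
  exact (congrArg (fun t => IsComul (BrCat.star hopf)
    (BrCat.homMk (gen .comul) ≫ t) (BrCat.homMk (gen .counit))) e).mpr
      (isComul_star.comp_braiding_zpow (BrCat.autMk _ _ _ _) rfl k)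

/-- The defining relations of the antipode hold after all antipodes are moved to the outputs. -/
theorem twist_rel {m n : ℕ} {f g : BraidTerm HopfGenS m n} (h : HopfRelS f g) (k : Fin m → ℤ) :
    hopf.Eqv (twist f k) (twist g k) ∧ out f k = out g k := by
  cases h with
  | base h =>
    cases h with
    | coassoc =>
      refine ⟨BrCat.homMk_eq_iff.1 ?_, ?_⟩
      · exact (isComul_twist (k 0)).coassoc.trans (congrArg
          (fun t : (⟨2⟩ : BrCat hopf) ⟶ ⟨3⟩ => BrCat.homMk (comp _ (zpow _ _ (k 0))) ≫ t)
          (Category.comp_id (BrCat.homMk (tens _ (idt 1)) : (⟨2⟩ : BrCat hopf) ⟶ ⟨3⟩)))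
      · ext i; fin_cases i <;> rfl
    | id_counit =>
      exact ⟨BrCat.homMk_eq_iff.1 (isComul_twist (k 0)).counit_right,
        by ext i; fin_cases i; rfl⟩
    | counit_id =>
      exact ⟨BrCat.homMk_eq_iff.1 (isComul_twist (k 0)).counit_left,
        by ext i; fin_cases i; rfl⟩
  | Sinv_S => exact ⟨.id_comp _, funext fun i => sub_add_cancel (k i) 1⟩
  | S_Sinv => exact ⟨.id_comp _, funext fun i => add_sub_cancel_right (k i) 1⟩
  | S_comul =>
    refine ⟨.trans (.id_comp _) (.trans (.comp_congr (.refl _) (braid_zpow_succ (k 0)))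
      (.trans (.symm (.assoc _ _ _)) (.comp_congr (.refl _) (.symm ?_)))), ?_⟩
    · exact .trans (.comp_congr (.refl _) (.tensor_id 1 1)) (.comp_id _)
    · ext i; fin_cases i <;> rfl
  | S_counit => exact ⟨.id_comp _, rfl⟩
  | S_thetaPos => exact ⟨.id_comp _, rfl⟩
  | S_thetaNeg => exact ⟨.id_comp _, rfl⟩
  | S_id_omegaPos =>
    refine ⟨.trans (.comp_congr (.tensor_id 1 1) (.refl _)) (.trans (.id_comp _) ?_), rfl⟩
    change hopf.Eqv (omegaPow (k 0 + 1 + k 1)) (omegaPow (k 0 + k 1 + 1))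
    rw [add_right_comm]
    exact .refl _
  | id_S_omegaPos =>
    refine ⟨.trans (.comp_congr (.tensor_id 1 1) (.refl _)) (.trans (.id_comp _) ?_), rfl⟩
    change hopf.Eqv (omegaPow (k 0 + (k 1 + 1))) (omegaPow (k 0 + k 1 + 1))
    rw [add_assoc]
    exact .refl _
  | Sinv_id_omegaPos =>
    refine ⟨.trans (.comp_congr (.tensor_id 1 1) (.refl _)) (.trans (.id_comp _) ?_), rfl⟩
    change hopf.Eqv (omegaPow (k 0 - 1 + k 1)) (comp (braid 1 1) (omegaPow (k 1 + k 0 + 1)))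
    rw [show k 1 + k 0 + 1 = k 0 - 1 + k 1 + 2 by ring]
    exact .symm (braid_omegaPow _)
  | id_Sinv_omegaPos =>
    refine ⟨.trans (.comp_congr (.tensor_id 1 1) (.refl _)) (.trans (.id_comp _) ?_), rfl⟩
    change hopf.Eqv (omegaPow (k 0 + (k 1 - 1))) (comp (braid 1 1) (omegaPow (k 1 + k 0 + 1)))
    rw [show k 1 + k 0 + 1 = k 0 + (k 1 - 1) + 2 by ring]
    exact .symm (braid_omegaPow _)

/-- Moving antipodes to the outputs is compatible with the congruences. -/
theorem twist_eqv {m n : ℕ} {f g : BraidTerm hopfS.G m n} (h : hopfS.Eqv f g) (k : Fin m → ℤ) :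
    hopf.Eqv (twist f k) (twist g k) ∧ out f k = out g k := by
  induction h with
  | rel h => exact twist_rel h k
  | refl => exact ⟨.refl _, rfl⟩
  | symm _ ih => exact ⟨.symm (ih k).1, (ih k).2.symm⟩
  | trans _ _ ih₁ ih₂ => exact ⟨.trans (ih₁ k).1 (ih₂ k).1, (ih₁ k).2.trans (ih₂ k).2⟩
  | comp_congr _ _ ih₁ ih₂ =>
    simp only [twist, out]
    rw [(ih₁ k).2]
    exact ⟨.comp_congr (ih₁ k).1 (ih₂ _).1, (ih₂ _).2⟩
  | tensor_congr _ _ ih₁ ih₂ =>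
    simp only [twist, out]
    rw [(ih₁ _).2, (ih₂ _).2]
    exact ⟨.tensor_congr (ih₁ _).1 (ih₂ _).1, rfl⟩
  | id_comp => exact ⟨.id_comp _, rfl⟩
  | comp_id => exact ⟨.comp_id _, rfl⟩
  | assoc => exact ⟨.assoc _ _ _, rfl⟩
  | tensor_id => exact ⟨.tensor_id _ _, append_left_right k⟩
  | tensor_comp =>
    simp only [twist, out, left_append, right_append]
    exact ⟨.tensor_comp _ _ _ _, trivial⟩
  | tensor_assoc =>
    simp only [twist_cast, out_cast, twist, out, left_left, right_left, right_cast]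
    refine ⟨.tensor_assoc _ _ _, ?_⟩
    rw [Fin.append_assoc]
    rfl
  | id_zero_tensor f =>
    have e : right (m := 0) (fun j => k (j.cast (Nat.zero_add _))) = k :=
      funext fun i => congrArg k (Fin.ext (Nat.zero_add i))
    simp only [twist_cast, out_cast, twist, out, e]
    refine ⟨.id_zero_tensor _, funext fun i => ?_⟩
    refine (congrArg _ (Fin.ext (Nat.zero_add i).symm)).trans (Fin.append_right _ (out f k) i)
  | tensor_id_zero f =>
    exact ⟨.tensor_id_zero _, funext fun i => Fin.append_left (out f k) _ i⟩
  | braid_braidInv =>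
    simp only [twist, out, left_append, right_append, append_left_right]
    exact ⟨.braid_braidInv _ _, trivial⟩
  | braidInv_braid =>
    simp only [twist, out, left_append, right_append, append_left_right]
    exact ⟨.braidInv_braid _ _, trivial⟩
  | braid_naturality =>
    simp only [twist, out, left_append, right_append]
    exact ⟨.braid_naturality _ _, trivial⟩
  | braid_tensor_right m n p =>
    simp only [twist_cast, out_cast, twist, out]
    refine ⟨.braid_tensor_right _ _ _, funext fun ⟨i, hi⟩ => ?_⟩
    simp only [append_apply, left, right, Fin.val_cast, Fin.val_castAdd, Fin.val_natAdd]
    split_ifs <;> first | omega | exact congrArg k (Fin.ext (by simp <;> omega))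
  | braid_tensor_left m n p =>
    simp only [twist_cast, out_cast, twist, out]
    refine ⟨.braid_tensor_left _ _ _, funext fun ⟨i, hi⟩ => ?_⟩
    simp only [append_apply, left, right, Fin.val_cast, Fin.val_castAdd, Fin.val_natAdd]
    split_ifs <;> first | omega | exact congrArg k (Fin.ext (by simp <;> omega))

/-! ### Diagrams without antipode are unchanged -/

theorem append_zero_zero (m n : ℕ) : Fin.append (0 : Fin m → ℤ) (0 : Fin n → ℤ) = 0 :=
  append_left_right (0 : Fin (m + n) → ℤ)

theorem twist_map_base {m n : ℕ} (t : BraidTerm HopfGen m n) :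
    hopf.Eqv (twist (t.map HopfGenS.base) 0) t ∧ out (t.map HopfGenS.base) 0 = 0 := by
  induction t with
  | gen g =>
    cases g with
    | comul => exact ⟨.comp_id _, rfl⟩
    | counit => exact ⟨.refl _, Subsingleton.elim _ _⟩
    | omegaPos => exact ⟨omegaPow_zero, Subsingleton.elim _ _⟩
    | omegaNeg => exact ⟨omegaPow_one, Subsingleton.elim _ _⟩
    | thetaPos => exact ⟨.refl _, Subsingleton.elim _ _⟩
    | thetaNeg => exact ⟨.refl _, Subsingleton.elim _ _⟩
  | idt n => exact ⟨.refl _, rfl⟩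
  | comp f g ihf ihg =>
    simp only [BraidTerm.map, twist, out]
    rw [ihf.2]
    exact ⟨.comp_congr ihf.1 ihg.1, ihg.2⟩
  | tens f g ihf ihg =>
    exact ⟨.tensor_congr ihf.1 ihg.1,
      (congrArg₂ Fin.append ihf.2 ihg.2).trans (append_zero_zero _ _)⟩
  | braid m n => exact ⟨.refl _, append_zero_zero _ _⟩
  | braidInv m n => exact ⟨.refl _, append_zero_zero _ _⟩

/-! ### Powers of an anti-comultiplicative automorphism -/

section Powers

universe v u

variable {𝒞 : Type u} [Category.{v} 𝒞]

theorem aut_zpow_add_one_hom {X : 𝒞} (a : Aut X) (k : ℤ) :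
    (a ^ (k + 1)).hom = a.hom ≫ (a ^ k).hom := by
  rw [zpow_add_one]; rfl

theorem aut_zpow_comp {X Y : 𝒞} (a : Aut X) (b : Aut Y) (f : X ⟶ Y)
    (h : a.hom ≫ f = f ≫ b.hom) (k : ℤ) : (a ^ k).hom ≫ f = f ≫ (b ^ k).hom := by
  induction k using Int.induction_on with
  | zero => exact (Category.id_comp f).trans (Category.comp_id f).symm
  | succ k ih =>
    rw [aut_zpow_add_one_hom, aut_zpow_add_one_hom, Category.assoc, ih, ← Category.assoc, h,
      Category.assoc]
  | pred k ih =>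
    have e := sub_add_cancel (-k : ℤ) 1
    rw [← e, aut_zpow_add_one_hom, aut_zpow_add_one_hom, Category.assoc, ← Category.assoc f, ← h,
      Category.assoc] at ih
    have : IsIso a.hom := Iso.isIso_hom a
    exact (cancel_epi a.hom).1 ih

theorem aut_zpow_shift {X Y : 𝒞} (a : Aut X) (w : ℤ → (X ⟶ Y))
    (h : ∀ k, a.hom ≫ w k = w (k + 1)) (i k : ℤ) : (a ^ i).hom ≫ w k = w (i + k) := by
  induction i using Int.induction_on with
  | zero => rw [zero_add]; exact Category.id_comp (w k)
  | succ i ih => rw [aut_zpow_add_one_hom, Category.assoc, ih, h, add_right_comm]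
  | pred i ih =>
    have e := sub_add_cancel (-i : ℤ) 1
    rw [← e, aut_zpow_add_one_hom, Category.assoc, add_right_comm, ← h] at ih
    have : IsIso a.hom := Iso.isIso_hom a
    exact (cancel_epi a.hom).1 ih

variable [MonoidalCategory 𝒞] [BraidedCategory 𝒞] {X : 𝒞}

/-- Anti-comultiplicativity of `s` passes to its powers: every factor of `s` contributes one
braiding. -/
theorem aut_zpow_comul (s : Aut X) (u : Aut (X ⊗ X)) (hu : u.hom = (β_ X X).hom) (d : X ⟶ X ⊗ X)
    (h : s.hom ≫ d = d ≫ (β_ X X).hom ≫ (s.hom ⊗ₘ s.hom)) (k : ℤ) :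
    (s ^ k).hom ≫ d = d ≫ (u ^ k).hom ≫ ((s ^ k).hom ⊗ₘ (s ^ k).hom) := by
  let φ : Aut X →* Aut (X ⊗ X) := MonoidHom.mk' (fun s => s ⊗ᵢ s) fun a b => by
    apply Iso.ext
    exact (tensorHom_comp_tensorHom b.hom b.hom a.hom a.hom).symm
  have hc : Commute (φ s) u := by
    apply Iso.ext
    change u.hom ≫ (s.hom ⊗ₘ s.hom) = (s.hom ⊗ₘ s.hom) ≫ u.hom
    rw [hu, BraidedCategory.braiding_naturality]
  have := aut_zpow_comp s (φ s * u) d (by rw [h, ← hu]; rfl) k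
  rwa [hc.mul_zpow, ← map_zpow] at this

/-- A family of forms on `X` that is shifted by `s`, on either side, is shifted by all its
powers. The braiding shifts the family by `-2`, so that two consecutive members suffice. -/
theorem aut_zpow_form (s : Aut X) (w : ℤ → (X ⊗ X ⟶ 𝟙_ 𝒞))
    (hw : ∀ j, (β_ X X).hom ≫ w (j + 2) = w j)
    (h₀ : s.hom ▷ X ≫ w 0 = w 1) (h₀' : X ◁ s.hom ≫ w 0 = w 1)
    (h₁ : s.hom ▷ X ≫ w (-1) = w 0) (h₁' : X ◁ s.hom ≫ w (-1) = w 0) (i j k : ℤ) :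
    ((s ^ i).hom ⊗ₘ (s ^ j).hom) ≫ w k = w (i + j + k) := by
  have up (j) (h : s.hom ▷ X ≫ w j = w (j + 1) ∧ X ◁ s.hom ≫ w j = w (j + 1)) :
      s.hom ▷ X ≫ w (j + 2) = w (j + 2 + 1) ∧ X ◁ s.hom ≫ w (j + 2) = w (j + 2 + 1) := by
    have e : (β_ X X).hom ≫ w (j + 2 + 1) = w (j + 1) := by
      rw [add_right_comm, hw]
    constructor <;> rw [← cancel_epi (β_ X X).hom, e]
    · rw [← h.2, ← hw j]; simp
    · rw [← h.1, ← hw j]; simp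
  have down (j) (h : s.hom ▷ X ≫ w (j + 2) = w (j + 2 + 1) ∧
      X ◁ s.hom ≫ w (j + 2) = w (j + 2 + 1)) :
      s.hom ▷ X ≫ w j = w (j + 1) ∧ X ◁ s.hom ≫ w j = w (j + 1) := by
    have e : (β_ X X).hom ≫ w (j + 2 + 1) = w (j + 1) := by
      rw [add_right_comm, hw]
    constructor
    · rw [← e, ← h.2, ← hw j]; simp
    · rw [← e, ← h.1, ← hw j]; simp
  have step (j) : (s.hom ▷ X ≫ w j = w (j + 1) ∧ X ◁ s.hom ≫ w j = w (j + 1)) ∧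
      (s.hom ▷ X ≫ w (j - 1) = w (j - 1 + 1) ∧ X ◁ s.hom ≫ w (j - 1) = w (j - 1 + 1)) := by
    induction j using Int.induction_on with
    | zero => exact ⟨⟨h₀, h₀'⟩, h₁, h₁'⟩
    | succ j ih =>
      have := up _ ih.2
      rw [show (j : ℤ) - 1 + 2 = j + 1 by ring] at this
      exact ⟨this, by rw [add_sub_cancel_right]; exact ih.1⟩
    | pred j ih =>
      refine ⟨ih.2, down _ ?_⟩
      rw [show (-j : ℤ) - 1 - 1 + 2 = -j by ring]
      exact ih.1
  have left := aut_zpow_shift ((tensorRight X).mapAut X s) w (fun k => (step k).1.1) i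
  have right := aut_zpow_shift ((tensorLeft X).mapAut X s) w (fun k => (step k).1.2) j
  rw [← map_zpow] at left right
  rw [MonoidalCategory.tensorHom_def, Category.assoc, add_assoc, ← left, ← right]
  rfl

end Powers

open HopfGen HopfGenS

/-! ### Moving antipodes through a diagram -/

/-- The `j`-th power of the antipode. -/
abbrev antipodeZPow (j : ℤ) : BraidTerm HopfGenS 1 1 := zpow (gen S) (gen Sinv) j

/-- The monoidal product of the powers of the antipode with exponents `k`. -/
def antipodePow : (n : ℕ) → (Fin n → ℤ) → BraidTerm HopfGenS n n
  | 0, _ => idt 0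
  | n + 1, k => tens (antipodePow n fun i => k i.castSucc) (antipodeZPow (k (Fin.last n)))

theorem antipodePow_zero (n : ℕ) : hopfS.Eqv (antipodePow n 0) (idt n) := by
  induction n with
  | zero => exact .refl _
  | succ n ih => exact .trans (.tensor_congr ih (.refl _)) (.tensor_id n 1)

theorem antipodePow_add (m : ℕ) : ∀ (n : ℕ) (k : Fin (m + n) → ℤ), hopfS.Eqv
    (antipodePow (m + n) k) (tens (antipodePow m (left k)) (antipodePow n (right k)))
  | 0, k => .symm (.tensor_id_zero _)
  | n + 1, k => by
    have h := Presentation.Eqv.tensor_assoc (P := hopfS) (antipodePow m (left k))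
      (antipodePow n (left (m' := 1) (right k))) (antipodeZPow (k (Fin.last (m + n))))
    exact .trans (.tensor_congr (antipodePow_add m n _) (.refl _)) h

theorem antipodePow_append {m n : ℕ} (k : Fin m → ℤ) (l : Fin n → ℤ) : hopfS.Eqv
    (antipodePow (m + n) (Fin.append k l)) (tens (antipodePow m k) (antipodePow n l)) := by
  have := antipodePow_add m n (Fin.append k l)
  rwa [left_append, right_append] at this

theorem antipodePow_one (k : Fin 1 → ℤ) : hopfS.Eqv (antipodePow 1 k) (antipodeZPow (k 0)) :=
  Presentation.Eqv.id_zero_tensor (P := hopfS) (antipodeZPow (k 0))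

theorem antipodePow_two (k : Fin 2 → ℤ) : hopfS.Eqv (antipodePow 2 k)
    (tens (antipodeZPow (k 0)) (antipodeZPow (k 1))) :=
  .tensor_congr (antipodePow_one _) (.refl _)

/-- The antipode as an automorphism of the generating object. -/
def antipode : Aut (BrCat.star hopfS) :=
  BrCat.autMk (P := hopfS) (gen S) (gen Sinv) (.rel .S_Sinv) (.rel .Sinv_S)

theorem homMk_antipodeZPow (j : ℤ) :
    (BrCat.homMk (P := hopfS) (antipodeZPow j) : BrCat.star hopfS ⟶ BrCat.star hopfS) =
      (antipode ^ j).hom :=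
  BrCat.homMk_zpow _ _ _ _ j

theorem map_zpow_braid (k : ℤ) :
    (zpow (braid 1 1) (braidInv 1 1) k).map HopfGenS.base =
      (zpow (braid 1 1) (braidInv 1 1) k : BraidTerm HopfGenS 2 2) := by
  cases k with
  | ofNat k =>
    induction k with
    | zero => rfl
    | succ k ih => exact congrArg (comp · (braid 1 1)) ih
  | negSucc k =>
    induction k with
    | zero => rfl
    | succ k ih => exact congrArg (comp · (braidInv 1 1)) ih

theorem antipodeZPow_comul (j : ℤ) : hopfS.Eqv (m := 1) (n := 2)
    (comp (antipodeZPow j) (gen (base comul)))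
    (comp (gen (base comul)) (comp (zpow (braid 1 1) (braidInv 1 1) j)
      (tens (antipodeZPow j) (antipodeZPow j)))) := by
  have h := aut_zpow_comul antipode
    (BrCat.autMk _ _ (.braid_braidInv 1 1) (.braidInv_braid 1 1)) rfl
    (BrCat.homMk (P := hopfS) (gen (base comul))) (BrCat.homMk_eq (.rel .S_comul)) j
  rw [← homMk_antipodeZPow] at h
  refine BrCat.homMk_eq_iff.1 (h.trans ?_)
  exact congrArg (fun t : (⟨2⟩ : BrCat hopfS) ⟶ ⟨2⟩ => BrCat.homMk (gen (base comul)) ≫ t ≫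
    BrCat.homMk (tens (antipodeZPow j) (antipodeZPow j)))
      (BrCat.homMk_zpow _ _ (.braid_braidInv 1 1) (.braidInv_braid 1 1) j).symm

theorem antipodeZPow_comp {g : HopfGen 1 0}
    (h : hopfS.Eqv (comp (gen S) (gen (base g))) (gen (base g))) (j : ℤ) :
    hopfS.Eqv (comp (antipodeZPow j) (gen (base g))) (gen (base g)) := by
  have := aut_zpow_comp antipode (1 : Aut (⟨0⟩ : BrCat hopfS))
    (BrCat.homMk (P := hopfS) (gen (base g)))
    ((BrCat.homMk_eq h).trans (Category.comp_id _).symm) j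
  rw [← homMk_antipodeZPow, one_zpow] at this
  exact BrCat.homMk_eq_iff.1 (this.trans (Category.comp_id _))

/-- Forms obtained from `ω_+` by powers of the antipode. -/
abbrev omegaPowS (j : ℤ) : BraidTerm HopfGenS 2 0 := (omegaPow j).map HopfGenS.base

theorem eqv_map_base {m n : ℕ} {f g : BraidTerm hopf.G m n} (h : hopf.Eqv f g) :
    hopfS.Eqv (f.map HopfGenS.base) (g.map HopfGenS.base) :=
  .map (P := hopf) (Q := hopfS) HopfGenS.base (fun h => .rel (.base h)) h

theorem antipodeZPow_omegaPow (i j k : ℤ) : hopfS.Eqv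
    (comp (tens (antipodeZPow i) (antipodeZPow j)) (omegaPowS k)) (omegaPowS (i + j + k)) := by
  -- The relations for `S⁻¹` say that it shifts `ω_+` to the member with index `-1`.
  have h₁ : hopfS.Eqv (omegaPowS (-1)) (comp (braid 1 1) (gen (base omegaNeg))) :=
    .trans (.symm (eqv_map_base (braid_omegaPow (-1))))
      (.comp_congr (.refl _) (eqv_map_base omegaPow_one))
  have h := aut_zpow_form antipode (fun k => BrCat.homMk (P := hopfS) (omegaPowS k))
    (fun j => BrCat.homMk_eq (eqv_map_base (braid_omegaPow j))) ?_ ?_ ?_ ?_ i j k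
  · rw [← homMk_antipodeZPow, ← homMk_antipodeZPow] at h
    exact BrCat.homMk_eq_iff.1 h
  · exact BrCat.homMk_eq (.trans (.comp_congr (.refl _) (eqv_map_base omegaPow_zero))
      (.trans (.rel .S_id_omegaPos) (.symm (eqv_map_base omegaPow_one))))
  · exact BrCat.homMk_eq (.trans (.comp_congr (.refl _) (eqv_map_base omegaPow_zero))
      (.trans (.rel .id_S_omegaPos) (.symm (eqv_map_base omegaPow_one))))
  · refine BrCat.homMk_eq (.trans (.comp_congr (.refl _) (h₁.trans
      (.symm (.rel .Sinv_id_omegaPos)))) (.trans (.symm (.assoc _ _ _))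
        (.trans (.comp_congr (.trans (.symm (.tensor_comp _ _ _ _)) (.trans
          (.tensor_congr (.rel .S_Sinv) (.id_comp _)) (.tensor_id 1 1))) (.refl _))
            (.trans (.id_comp _) (.symm (eqv_map_base omegaPow_zero))))))
  · refine BrCat.homMk_eq (.trans (.comp_congr (.refl _) (h₁.trans
      (.symm (.rel .id_Sinv_omegaPos)))) (.trans (.symm (.assoc _ _ _))
        (.trans (.comp_congr (.trans (.symm (.tensor_comp _ _ _ _)) (.trans
          (.tensor_congr (.id_comp _) (.rel .S_Sinv)) (.tensor_id 1 1))) (.refl _))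
            (.trans (.id_comp _) (.symm (eqv_map_base omegaPow_zero))))))

theorem antipodePow_comp_gen {m n : ℕ} (g : HopfGenS m n) (k : Fin m → ℤ) : hopfS.Eqv
    (comp (antipodePow m k) (gen g))
    (comp ((genTwist g k).map HopfGenS.base) (antipodePow n (genOut g k))) := by
  cases g with
  | base g =>
    cases g with
    | comul =>
      refine .trans (.comp_congr (antipodePow_one k) (.refl _))
        (.trans (antipodeZPow_comul (k 0)) (.trans (.symm (.assoc _ _ _))
          (.comp_congr (.comp_congr (.refl _) ?_) (.symm (antipodePow_two _)))))
      rw [map_zpow_braid]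
      exact .refl _
    | counit =>
      exact .trans (.comp_congr (antipodePow_one k) (.refl _))
        (.trans (antipodeZPow_comp (.rel .S_counit) (k 0)) (.symm (.comp_id _)))
    | thetaPos =>
      exact .trans (.comp_congr (antipodePow_one k) (.refl _))
        (.trans (antipodeZPow_comp (.rel .S_thetaPos) (k 0)) (.symm (.comp_id _)))
    | thetaNeg =>
      exact .trans (.comp_congr (antipodePow_one k) (.refl _))
        (.trans (antipodeZPow_comp (.rel .S_thetaNeg) (k 0)) (.symm (.comp_id _)))
    | omegaPos =>
      refine .trans (.comp_congr (antipodePow_two k) (.symm (eqv_map_base omegaPow_zero)))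
        (.trans (antipodeZPow_omegaPow (k 0) (k 1) 0) ?_)
      rw [add_zero]
      exact .symm (.comp_id _)
    | omegaNeg =>
      exact .trans (.comp_congr (antipodePow_two k) (.symm (eqv_map_base omegaPow_one)))
        (.trans (antipodeZPow_omegaPow (k 0) (k 1) 1) (.symm (.comp_id _)))
  | S =>
    refine .trans (.comp_congr (antipodePow_one k) (.refl _))
      (.trans ?_ (.symm (.trans (.id_comp _) (antipodePow_one _))))
    exact .symm (.zpow_add_one (P := hopfS) (.rel .S_Sinv) (.rel .Sinv_S) (k 0))
  | Sinv =>
    refine .trans (.comp_congr (antipodePow_one k) (.refl _))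
      (.trans ?_ (.symm (.trans (.id_comp _) (antipodePow_one _))))
    have h := Presentation.Eqv.zpow_add_one (P := hopfS) (t := gen S) (t' := gen Sinv)
      (.rel .S_Sinv) (.rel .Sinv_S) (k 0 - 1)
    rw [sub_add_cancel] at h
    exact .trans (.comp_congr h (.refl _)) (.trans (.assoc _ _ _)
      (.trans (.comp_congr (.refl _) (.rel .S_Sinv)) (.comp_id _)))

/-- Powers of the antipode at the inputs of a diagram can be moved to its outputs, together with
all antipodes in the diagram. -/
theorem antipodePow_comp {m n : ℕ} (t : BraidTerm HopfGenS m n) (k : Fin m → ℤ) : hopfS.Eqv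
    (comp (antipodePow m k) t)
    (comp ((twist t k).map HopfGenS.base) (antipodePow n (out t k))) := by
  induction t with
  | gen g => exact antipodePow_comp_gen g k
  | idt n => exact .trans (.comp_id _) (.symm (.id_comp _))
  | comp f g ihf ihg =>
    exact .trans (.symm (.assoc _ _ _)) (.trans (.comp_congr (ihf k) (.refl _))
      (.trans (.assoc _ _ _) (.trans (.comp_congr (.refl _) (ihg _)) (.symm (.assoc _ _ _)))))
  | tens f g ihf ihg =>
    exact .trans (.comp_congr (antipodePow_add _ _ k) (.refl _))
      (.trans (.symm (.tensor_comp _ _ _ _)) (.trans (.tensor_congr (ihf _) (ihg _))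
        (.trans (.tensor_comp _ _ _ _) (.comp_congr (.refl _) (.symm (antipodePow_append _ _))))))
  | braid m n =>
    exact .trans (.comp_congr (antipodePow_add _ _ k) (.refl _))
      (.trans (.braid_naturality _ _) (.comp_congr (.refl _) (.symm (antipodePow_append _ _))))
  | braidInv m n =>
    -- naturality of the inverse braiding, from that of the braiding
    refine .trans (.symm (.id_comp _)) (.trans (.comp_congr (.symm (.braidInv_braid m n)) (.refl _))
      (.trans (.assoc _ _ _) (.comp_congr (.refl _) ?_)))
    refine .trans (.symm (.assoc _ _ _)) (.trans (.comp_congr (.trans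
      (.comp_congr (.refl _) (antipodePow_add _ _ k)) (.trans (.symm (.braid_naturality _ _))
        (.comp_congr (.symm (antipodePow_append _ _)) (.refl _)))) (.refl _)) ?_)
    exact .trans (.assoc _ _ _) (.trans (.comp_congr (.refl _) (.braid_braidInv m n)) (.comp_id _))

/-! ### The isomorphism -/

/-- On morphisms to the unit object the inclusion is injective and surjective. -/
theorem inclusion_map_bijective (X : BrCat hopf) : Function.Bijective
    (fun f : X ⟶ 𝟙_ (BrCat hopf) => inclusion.map f) := by
  constructor
  · intro f g h
    obtain ⟨s, rfl⟩ := BrCat.homMk_surj f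
    obtain ⟨t, rfl⟩ := BrCat.homMk_surj g
    have e := (twist_eqv (BrCat.homMk_eq_iff.1 h) 0).1
    exact BrCat.homMk_eq (.trans (.symm (twist_map_base s).1) (.trans e (twist_map_base t).1))
  · intro f
    obtain ⟨t, rfl⟩ := BrCat.homMk_surj f
    refine ⟨BrCat.homMk (twist t 0), BrCat.homMk_eq ?_⟩
    exact .symm (.trans (.symm (.id_comp _)) (.trans
      (.comp_congr (.symm (antipodePow_zero _)) (.refl _))
      (.trans (antipodePow_comp t 0) (.comp_id _))))

theorem iota_map_bijective (m n : Diag) :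
    Function.Bijective (fun f : m ⟶ n => iota.map f) := by
  constructor
  · rintro ⟨h, f⟩ ⟨_, g⟩ e
    have e' : eqToHom (BrCat.compat_tpow m.deg).obj ≫ inclusion.map f =
      eqToHom (BrCat.compat_tpow m.deg).obj ≫ inclusion.map g := congrArg ConvCat.Hom.val e
    exact ConvCat.Hom.ext ((inclusion_map_bijective _).1 ((cancel_epi _).1 e'))
  · rintro ⟨h, f⟩
    obtain ⟨g, hg⟩ := (inclusion_map_bijective (tpow (BrCat.star hopf) m.deg)).2
      (eqToHom (BrCat.compat_tpow m.deg).obj.symm ≫ f)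
    refine ⟨⟨h, g⟩, ConvCat.Hom.ext ?_⟩
    refine (congrArg (eqToHom (BrCat.compat_tpow m.deg).obj ≫ ·) hg).trans ?_
    exact (eqToHom_trans_assoc _ _ _).trans (Category.id_comp _)

/-- The unique Hopf diagram without antipode that represents a given Hopf diagram. -/
noncomputable def removeAntipode {m n : DiagS} (f : m ⟶ n) : (⟨m.deg⟩ : Diag) ⟶ ⟨n.deg⟩ :=
  ((iota_map_bijective ⟨m.deg⟩ ⟨n.deg⟩).2 f).choose

theorem iota_map_removeAntipode {m n : DiagS} (f : m ⟶ n) : iota.map (removeAntipode f) = f :=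
  ((iota_map_bijective ⟨m.deg⟩ ⟨n.deg⟩).2 f).choose_spec

/-- The functor inverse to `iota`. -/
noncomputable def iotaInv : DiagS ⥤ Diag where
  obj n := ⟨n.deg⟩
  map := removeAntipode
  map_id n := (iota_map_bijective _ _).1
    ((iota_map_removeAntipode (𝟙 n)).trans (iota.map_id ⟨n.deg⟩).symm)
  map_comp f g := (iota_map_bijective _ _).1 ((iota_map_removeAntipode (f ≫ g)).trans
    ((iota.map_comp (removeAntipode f) (removeAntipode g)).trans
      (congrArg₂ (· ≫ ·) (iota_map_removeAntipode f) (iota_map_removeAntipode g))).symm)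

end HopfDiagrams

theorem theorem1p1 :
    ∃ κ : HopfDiagrams.DiagS ⥤ HopfDiagrams.Diag,
      HopfDiagrams.iota ⋙ κ = 𝟭 HopfDiagrams.Diag ∧
        κ ⋙ HopfDiagrams.iota = 𝟭 HopfDiagrams.DiagS := by
  refine ⟨HopfDiagrams.iotaInv, CategoryTheory.Functor.ext (fun _ => rfl) fun m n f => ?_,
    CategoryTheory.Functor.ext (fun _ => rfl) fun m n f => ?_⟩
  · refine Eq.trans ?_ ((Category.id_comp _).trans (Category.comp_id _)).symm
    exact (HopfDiagrams.iota_map_bijective m n).1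
      (HopfDiagrams.iota_map_removeAntipode (HopfDiagrams.iota.map f))
  · refine Eq.trans ?_ ((Category.id_comp _).trans (Category.comp_id _)).symm
    exact HopfDiagrams.iota_map_removeAntipode f
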